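/- Let $\mathcal{H}$ and $\mathcal{K}$ be finite-dimensional complex Hilbert spaces, $d=\dim\mathcal{H}\geq 1$, and let $n\geq 0$ be an integer. Write $\mathcal{D}(\mathcal{H})$ for the set of states (positive semidefinite operators of trace $1$) on $\mathcal{H}$, and let $F(\rho,\sigma)=\|\sqrt{\rho}\sqrt{\sigma}\|_1$ be the fidelity, $\|\cdot\|_1$ being the trace norm. Let $\mu$ be the Borel probability measure on $\mathcal{D}(\mathcal{H})$ that is the law of the reduced state $\mathrm{Tr}_{\mathcal{H}'}|\psi\rangle\langle\psi|$, where $\mathcal{H}'$ is a copy of $\mathcal{H}$ and $\psi$ is uniformly distributed on the unit sphere of $\mathcal{H}\otimes\mathcal{H}'$. For operators, $A\leq B$ means that $B-A$ is positive semidefinite. Let $\mathcal{N}:\mathcal{L}(\mathcal{H})\to\mathcal{L}(\mathcal{K})$ be a quantum channel (a completely positive trace-preserving linear map), let $\tau_0$ be a state on $\mathcal{K}$, and let $\rho$ be a symmetric state on $\mathcal{H}^{\otimes n}$, i.e. $U_\pi\rho U_\pi^\dagger=\rho$ for every permutation $\pi\in\mathcal{S}_n$, where $U_\pi$ is the unitary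 permuting the tensor factors, $U_\pi|j_1\rangle\otimes\cdots\otimes|j_n\rangle=|j_{\pi(1)}\rangle\otimes\cdots\otimes|j_{\pi(n)}\rangle$. Assume that $\mathcal{N}^{\otimes n}(\rho)=\tau_0^{\otimes n}$. Then \[ \rho\leq (n+1)^{3d^2}\int_{\mathcal{D}(\mathcal{H})}F\left(\tau_0,\mathcal{N}(\sigma)\right)^{2n}\,\sigma^{\otimes n}\,\mathrm{d}\mu(\sigma). \] Moreover, for every $0<\delta<1$, setting $\mathcal{K}_\delta=\{\sigma\in\mathcal{D}(\mathcal{H}) : F(\tau_0,\mathcal{N}(\sigma))\geq 1-\delta\}$, \[ \rho\leq (n+1)^{3d^2}\left(\int_{\sigma\in\mathcal{K}_\delta}\sigma^{\otimes n}\,\mathrm{d}\mu(\sigma)+(1-\delta)^{2n}\int_{\sigma\notin\mathcal{K}_\delta}\sigma^{\otimes n}\,\mathrm{d}\mu(\sigma)\right). \] -/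

import Mathlib

open scoped MatrixOrder ComplexOrder Matrix.Norms.L2Operator CStarAlgebra

noncomputable section

namespace DeFinetti

open MeasureTheory

/-- States (density matrices) on the Hilbert space `ℂ^ι`: positive semidefinite matrices of
trace one. -/
abbrev State (ι : Type*) [Fintype ι] : Type _ :=
  {ρ : Matrix ι ι ℂ // ρ.PosSemidef ∧ ρ.trace = 1}

/-- The Borel σ-algebra on the set of states. -/
instance State.instMeasurableSpace (ι : Type*) [Fintype ι] [DecidableEq ι] :
    MeasurableSpace (State ι) := borel _

instance State.instBorelSpace (ι : Type*) [Fintype ι] [DecidableEq ι] : BorelSpace (State ι) :=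
  ⟨rfl⟩

/-- The permutation unitary `U_π` on `(ℂ^ι)^{⊗n}`, whose product basis is indexed by the tuples
`j : Fin n → ι`. It maps the basis vector `|j₁⟩ ⊗ ⋯ ⊗ |jₙ⟩` to `|j_{π(1)}⟩ ⊗ ⋯ ⊗ |j_{π(n)}⟩`. -/
def permUnitary {ι : Type*} [DecidableEq ι] {n : ℕ} (π : Equiv.Perm (Fin n)) :
    Matrix (Fin n → ι) (Fin n → ι) ℂ :=
  Matrix.of fun i j => if i = j ∘ π then 1 else 0

/-- Symmetric (permutation-invariant) operators on `(ℂ^ι)^{⊗n}`. -/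
def IsSymmetric {ι : Type*} [Fintype ι] [DecidableEq ι] {n : ℕ}
    (ρ : Matrix (Fin n → ι) (Fin n → ι) ℂ) : Prop :=
  ∀ π : Equiv.Perm (Fin n), permUnitary π * ρ * (permUnitary π).conjTranspose = ρ

/-- The tensor product `A₁ ⊗ ⋯ ⊗ Aₙ` in the product basis. -/
def tensorProd {ι : Type*} {n : ℕ} (A : Fin n → Matrix ι ι ℂ) :
    Matrix (Fin n → ι) (Fin n → ι) ℂ :=
  Matrix.of fun i j => ∏ t, A t (i t) (j t)

/-- The tensor power `A^{⊗n}`. -/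
def tensorPow {ι : Type*} (n : ℕ) (A : Matrix ι ι ℂ) : Matrix (Fin n → ι) (Fin n → ι) ℂ :=
  tensorProd fun _ => A

/-- The tensor power `N^{⊗n}` of a linear map between matrix spaces: the linear map that sends
each product matrix unit `|i₁⟩⟨j₁| ⊗ ⋯ ⊗ |iₙ⟩⟨jₙ|` to `N(|i₁⟩⟨j₁|) ⊗ ⋯ ⊗ N(|iₙ⟩⟨jₙ|)`. -/
def tensorPowMap {ι κ : Type*} [Fintype ι] [DecidableEq ι] (n : ℕ)
    (N : Matrix ι ι ℂ →ₗ[ℂ] Matrix κ κ ℂ) :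
    Matrix (Fin n → ι) (Fin n → ι) ℂ →ₗ[ℂ] Matrix (Fin n → κ) (Fin n → κ) ℂ where
  toFun X := ∑ i, ∑ j, X i j • tensorProd fun t => N (Matrix.single (i t) (j t) 1)
  map_add' X Y := by simp [add_smul, Finset.sum_add_distrib]
  map_smul' c X := by simp [mul_smul, Finset.smul_sum]

/-- `N^{⊗n}(A₁ ⊗ ⋯ ⊗ Aₙ) = N(A₁) ⊗ ⋯ ⊗ N(Aₙ)`. -/
theorem tensorPowMap_tensorProd {ι κ : Type*} [Fintype ι] [DecidableEq ι] (n : ℕ)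
    (N : Matrix ι ι ℂ →ₗ[ℂ] Matrix κ κ ℂ) (A : Fin n → Matrix ι ι ℂ) :
    tensorPowMap n N (tensorProd A) = tensorProd fun t => N (A t) := by
  ext k l
  have hA : ∀ t, N (A t) (k t) (l t) =
      ∑ p : ι × ι, A t p.1 p.2 * N (Matrix.single p.1 p.2 1) (k t) (l t) := by
    intro t
    conv_lhs => rw [Matrix.matrix_eq_sum_single (A t)]
    simp only [map_sum, Matrix.sum_apply, Fintype.sum_prod_type]
    refine Finset.sum_congr rfl fun i _ => Finset.sum_congr rfl fun j _ => ?_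
    rw [show Matrix.single i j (A t i j) = A t i j • Matrix.single i j (1 : ℂ) by simp, map_smul]
    simp
  simp only [tensorPowMap, tensorProd, LinearMap.coe_mk, AddHom.coe_mk, Matrix.sum_apply,
    Matrix.smul_apply, Matrix.of_apply, smul_eq_mul, hA, Finset.prod_univ_sum,
    Fintype.piFinset_univ, ← Finset.prod_mul_distrib]
  rw [← Fintype.sum_prod_type', ← (Equiv.arrowProdEquivProdArrow (Fin n) _ _).sum_comp]
  rfl

/-- The trace norm `‖A‖₁ = Tr |A|`, where `|A| = √(A† A)`. -/
def traceNorm {ι : Type*} [Fintype ι] [DecidableEq ι] (A : Matrix ι ι ℂ) : ℝ :=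
  (CFC.abs A).trace.re

/-- The fidelity `F(ρ, σ) = ‖√ρ √σ‖₁`. -/
def fidelity {ι : Type*} [Fintype ι] [DecidableEq ι] (ρ σ : Matrix ι ι ℂ) : ℝ :=
  traceNorm (CFC.sqrt ρ * CFC.sqrt σ)

/-- The rank-one operator `|ψ⟩⟨ψ|`. -/
def pureState {ι : Type*} (ψ : EuclideanSpace ℂ ι) : Matrix ι ι ℂ :=
  Matrix.vecMulVec ψ (star ψ)

/-- The partial trace over the second tensor factor. -/
def partialTrace {ι ι' : Type*} [Fintype ι'] (X : Matrix (ι × ι') (ι × ι') ℂ) : Matrix ι ι ℂ :=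
  Matrix.of fun i j => ∑ k, X (i, k) (j, k)

/-- The reduced state `σ(ψ) = Tr_{H'} |ψ⟩⟨ψ|` on `H = ℂ^ι` of a unit vector `ψ` of `H ⊗ H'`,
where `H'` is a copy of `H`. -/
def reducedState {ι : Type*} [Fintype ι]
    (ψ : Metric.sphere (0 : EuclideanSpace ℂ (ι × ι)) 1) : State ι :=
  ⟨partialTrace (pureState ψ.1), by
    classical
    constructor
    · have h : partialTrace (pureState ψ.1) =
          ∑ k, Matrix.vecMulVec (fun i => ψ.1 (i, k)) (star fun i => ψ.1 (i, k)) := by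
        ext i j
        simp [partialTrace, pureState, Matrix.vecMulVec_apply, Matrix.sum_apply]
      rw [h]
      exact Matrix.posSemidef_sum _ fun k _ => Matrix.posSemidef_vecMulVec_self_star _
    · have h : ‖ψ.1‖ ^ 2 = 1 := by rw [mem_sphere_zero_iff_norm.mp ψ.2]; norm_num
      rw [EuclideanSpace.norm_sq_eq] at h
      simp only [Matrix.trace, Matrix.diag, partialTrace, pureState, Matrix.vecMulVec_apply,
        Matrix.of_apply]
      rw [← Fintype.sum_prod_type' (f := fun i k => ψ.1 (i, k) * star (fun p => ψ.1 p) (i, k))]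
      have h2 : ∀ p, ψ.1 p * star (fun p => ψ.1 p) p = ((‖ψ.1 p‖ ^ 2 : ℝ) : ℂ) := by
        intro p
        simpa using Complex.mul_conj' (ψ.1 p)
      simp only [h2]
      exact_mod_cast h⟩

/-- The uniform probability measure on the unit sphere of `ℂ^ι`. -/
def sphereMeasure (ι : Type*) [Fintype ι] :
    Measure (Metric.sphere (0 : EuclideanSpace ℂ ι) 1) :=
  ((volume : Measure (EuclideanSpace ℂ ι)).toSphere Set.univ)⁻¹ •
    (volume : Measure (EuclideanSpace ℂ ι)).toSphere

/-- The universal probability measure `μ` on the set of states on `H = ℂ^ι`: the law of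
`σ(ψ) = Tr_{H'} |ψ⟩⟨ψ|` for `ψ` uniformly distributed on the unit sphere of `H ⊗ H'`. -/
def stateMeasure (ι : Type*) [Fintype ι] [DecidableEq ι] : Measure (State ι) :=
  (sphereMeasure (ι × ι)).map reducedState

theorem continuous_reducedState (ι : Type*) [Fintype ι] [DecidableEq ι] :
    Continuous (reducedState (ι := ι)) := by
  refine Continuous.subtype_mk (continuous_matrix fun i j => ?_) _
  simp only [partialTrace, pureState, Matrix.of_apply, Matrix.vecMulVec_apply]
  refine continuous_finsetSum _ fun k _ => ?_
  simp only [Pi.star_apply]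
  fun_prop

instance sphereMeasure.instIsProbabilityMeasure (ι : Type*) [Fintype ι] [Nonempty ι] :
    IsProbabilityMeasure (sphereMeasure ι) := by
  constructor
  have h0 : (volume : Measure (EuclideanSpace ℂ ι)).toSphere Set.univ ≠ 0 := by
    have : Nonempty (Metric.sphere (0 : EuclideanSpace ℂ ι) 1) :=
      (NormedSpace.sphere_nonempty.mpr zero_le_one).to_subtype
    exact isOpen_univ.measure_ne_zero _ Set.univ_nonempty
  have h1 : (volume : Measure (EuclideanSpace ℂ ι)).toSphere Set.univ ≠ ⊤ := measure_ne_top _ _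
  rw [sphereMeasure, Measure.smul_apply, smul_eq_mul, ENNReal.inv_mul_cancel h0 h1]

instance stateMeasure.instIsProbabilityMeasure (ι : Type*) [Fintype ι] [DecidableEq ι]
    [Nonempty ι] : IsProbabilityMeasure (stateMeasure ι) :=
  Measure.isProbabilityMeasure_map (continuous_reducedState ι).measurable.aemeasurable

end DeFinetti

end

/-!
The inequality is reduced to a resolution of the identity on the symmetric subspace.

Let `m = d²`. By computing Gaussian integrals in polar coordinates, the moments of the uniform
measure on the unit sphere of `ℂ^m` are found to be multiples of the number of permutations that
match two tuples of indices (`integral_sphere_prod_mul_conj`). Hence `D ∫ |ψ⟩⟨ψ|^{⊗n} dψ` is the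
identity on symmetric vectors, where `D = (n + m - 1)! / (n! (m - 1)!) ≤ (n + 1)^m`
(`sum_integral_mul_of_symmetric`, `symDim_le`).

The matrix `√ρ`, read as a vector `φ` of `(H ⊗ H')^{⊗n}`, is a symmetric purification of `ρ`. For a
vector `v` put `q = ⟨v, ρ v⟩` and let `w` be the partial contraction of `φ` with `v`, so that
`‖w‖² = q` and `q = ⟨v ⊗ w, φ⟩ = D ∫ ⟨v ⊗ w, ψ^{⊗n}⟩ ⟨ψ^{⊗n}, φ⟩ dψ`. Here
`|⟨v ⊗ w, ψ^{⊗n}⟩|² ≤ q ⟨v, σ(ψ)^{⊗n} v⟩`, while `|⟨ψ^{⊗n}, φ⟩| ≤ F(τ₀, N(σ(ψ)))^n`. The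
Cauchy–Schwarz inequality on the sphere thus gives
`q ≤ D² ∫ F(τ₀, N(σ))^{2n} ⟨v, σ^{⊗n} v⟩ dμ(σ)` (`quadForm_le_integral`), and
`D² ≤ (n + 1)^{2d²}`.

The bound on the overlap with `φ` combines three facts about the fidelity: the overlap of two
purifications is at most the fidelity (`norm_trace_conjTranspose_mul_le_fidelity`, from the polar
decomposition `exists_polar`); a channel with Kraus operators carries purifications to purifications
with the same overlap (`IsKraus.norm_trace_le_fidelity`, with Kraus operators provided by
`exists_isKraus`); and the fidelity is multiplicative on tensor powers (`fidelity_tensorPow`).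

The second inequality follows from the first, since `F ≤ 1` everywhere and `F < 1 - δ` off `K_δ`.
-/

noncomputable section

namespace DeFinetti

open MeasureTheory Matrix

/-! ### Moments of the uniform measure on the complex unit sphere -/

/-- The Gaussian weight makes the monomials `z ^ a` orthogonal on `ℂ`: the case `a ≠ b` is
rotation invariance. -/
theorem integral_pow_mul_conj_pow_mul_exp (a b : ℕ) :
    ∫ z : ℂ, z ^ a * star z ^ b * (Real.exp (-‖z‖ ^ 2) : ℂ) =
      if a = b then (Real.pi : ℂ) * (a.factorial : ℂ) else 0 := by
  split_ifs with h
  · subst h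
    have h1 : ∀ z : ℂ, z ^ a * star z ^ a * (Real.exp (-‖z‖ ^ 2) : ℂ) =
        ((‖z‖ ^ ((2 * a : ℕ) : ℝ) * Real.exp (-‖z‖ ^ (2 : ℝ)) : ℝ) : ℂ) := by
      intro z
      rw [← mul_pow, show z * star z = ((‖z‖ ^ 2 : ℝ) : ℂ) by simpa using Complex.mul_conj' z,
        Real.rpow_natCast, Real.rpow_two, pow_mul]
      push_cast
      rfl
    simp only [h1]
    rw [integral_complex_ofReal, Complex.integral_rpow_mul_exp_neg_rpow (by norm_num)
      (by push_cast; linarith [Nat.cast_nonneg (α := ℝ) a])]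
    rw [show (((2 * a : ℕ) : ℝ) + 2) / 2 = a + 1 by push_cast; ring, Real.Gamma_nat_eq_factorial]
    push_cast
    ring
  · set I := ∫ z : ℂ, z ^ a * star z ^ b * (Real.exp (-‖z‖ ^ 2) : ℂ) with hI
    -- a rotation by the angle `1` multiplies the integral by `exp (i (a - b)) ≠ 1`
    set u : Circle := Circle.exp 1 with hu
    have h1 : I = (u : ℂ) ^ a * star (u : ℂ) ^ b * I := by
      have h2 := (rotation u).measurePreserving.integral_comp
        (rotation u).toHomeomorph.measurableEmbedding
        (fun z : ℂ => z ^ a * star z ^ b * (Real.exp (-‖z‖ ^ 2) : ℂ))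
      rw [hI, ← integral_const_mul, ← h2]
      refine integral_congr_ae (.of_forall fun z => ?_)
      simp only [rotation_apply, star_mul', mul_pow, norm_mul, Circle.norm_coe, one_mul]
      ring
    by_contra hne
    have h3 : (u : ℂ) ^ a * star (u : ℂ) ^ b = 1 := by
      have := mul_right_cancel₀ hne (h1.symm.trans (one_mul I).symm)
      exact this
    have h4 : (u : ℂ) ^ a = (u : ℂ) ^ b := by
      have h5 : star (u : ℂ) * (u : ℂ) = 1 := by
        have := Complex.conj_mul' (u : ℂ)
        rw [Circle.norm_coe] at this
        exact this.trans (by simp)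
      calc (u : ℂ) ^ a = (u : ℂ) ^ a * (star (u : ℂ) * u) ^ b := by rw [h5]; simp
        _ = _ := by rw [mul_pow, ← mul_assoc, h3, one_mul]
    have h6 : Complex.exp (((a : ℝ) - b : ℝ) * Complex.I) = 1 := by
      simp only [hu, Circle.coe_exp, ← Complex.exp_nat_mul] at h4
      push_cast
      rw [sub_mul, Complex.exp_sub, div_eq_one_iff_eq (Complex.exp_ne_zero _)]
      simpa using h4
    obtain ⟨k, hk⟩ := Complex.exp_eq_one_iff.mp h6
    have h7 : ((a : ℝ) - b) = k * (2 * Real.pi) := by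
      have h8 : (((a : ℝ) - b : ℝ) : ℂ) * Complex.I =
          ((k * (2 * Real.pi) : ℝ) : ℂ) * Complex.I := by
        rw [hk]; push_cast; ring
      exact_mod_cast mul_right_cancel₀ Complex.I_ne_zero h8
    have hk0 : k ≠ 0 := by
      rintro rfl
      apply h
      simp [sub_eq_zero] at h7
      exact h7
    refine irrational_pi.ne_rational ((a : ℤ) - b) (2 * k) ?_
    have : (2 * k : ℝ) ≠ 0 := by
      simpa using hk0
    push_cast
    field_simp
    linarith

theorem integral_prod_pow_mul_conj_pow_mul_exp {ι : Type*} [Fintype ι] (a b : ι → ℕ) :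
    ∫ z : ι → ℂ, ∏ x, (z x ^ a x * star (z x) ^ b x * (Real.exp (-‖z x‖ ^ 2) : ℂ)) =
      if a = b then (Real.pi : ℂ) ^ Fintype.card ι * ∏ x, ((a x).factorial : ℂ) else 0 := by
  rw [integral_fintype_prod_volume_eq_prod
    (fun x (z : ℂ) => z ^ a x * star z ^ b x * (Real.exp (-‖z‖ ^ 2) : ℂ))]
  simp only [integral_pow_mul_conj_pow_mul_exp]
  split_ifs with h
  · subst h
    simp [Finset.prod_mul_distrib]
  · obtain ⟨x, hx⟩ := Function.ne_iff.mp h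
    exact Finset.prod_eq_zero (Finset.mem_univ x) (by simp [hx])

/-- The number of permutations carrying the tuple `j` to `i`, in terms of the multiplicities. -/
theorem card_perm_comp_eq {ι : Type*} [Fintype ι] [DecidableEq ι] {n : ℕ} (i j : Fin n → ι) :
    (Fintype.card {π : Equiv.Perm (Fin n) // i = j ∘ π}) =
      if (fun x => Fintype.card {t // i t = x}) = (fun x => Fintype.card {t // j t = x})
      then ∏ x, (Fintype.card {t // i t = x}).factorial else 0 := by
  split_ifs with h
  · have h1 : ∃ π : Equiv.Perm (Fin n), i = j ∘ π := by
      have e : ∀ x, Nonempty ({t // i t = x} ≃ {t // j t = x}) := fun x =>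
        ⟨Fintype.equivOfCardEq (congrFun h x)⟩
      replace e := fun x => (e x).some
      refine ⟨(Equiv.sigmaFiberEquiv i).symm.trans ((Equiv.sigmaCongrRight e).trans
        (Equiv.sigmaFiberEquiv j)), ?_⟩
      funext t
      exact ((e (i t) ⟨t, rfl⟩).2).symm
    obtain ⟨π₀, h0⟩ := h1
    rw [← DomMulAct.stabilizer_card i]
    refine Fintype.card_congr (Equiv.subtypeEquiv (Equiv.mulLeft π₀⁻¹) fun π => ?_)
    rw [h0]
    constructor
    · intro h2
      funext t
      simpa using (congrFun h2 t).symm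
    · intro h2
      funext t
      simpa using (congrFun h2 t).symm
  · rw [Fintype.card_eq_zero_iff]
    refine ⟨fun ⟨π, hπ⟩ => h ?_⟩
    funext x
    exact Fintype.card_congr (Equiv.subtypeEquiv π fun t => by rw [hπ]; rfl)

theorem prod_comp_eq_prod_pow {ι : Type*} [Fintype ι] [DecidableEq ι] {n : ℕ} (i : Fin n → ι)
    (f : ι → ℂ) : ∏ t, f (i t) = ∏ x, f x ^ Fintype.card {t // i t = x} := by
  rw [← Finset.prod_fiberwise' Finset.univ i f]
  refine Finset.prod_congr rfl fun x _ => ?_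
  rw [Finset.prod_const, Fintype.card_subtype]

/-- The Gaussian moments of products of coordinates (a form of Wick's formula). -/
theorem integral_prod_mul_conj_mul_exp {ι : Type*} [Fintype ι] [DecidableEq ι] {n : ℕ}
    (i j : Fin n → ι) :
    ∫ z : ι → ℂ, (∏ t, z (i t) * star (z (j t))) * (Real.exp (-∑ x, ‖z x‖ ^ 2) : ℂ) =
      (Real.pi : ℂ) ^ Fintype.card ι * Fintype.card {π : Equiv.Perm (Fin n) // i = j ∘ π} := by
  have h1 : ∀ z : ι → ℂ, (∏ t, z (i t) * star (z (j t))) * (Real.exp (-∑ x, ‖z x‖ ^ 2) : ℂ) =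
      ∏ x, (z x ^ Fintype.card {t // i t = x} * star (z x) ^ Fintype.card {t // j t = x} *
        (Real.exp (-‖z x‖ ^ 2) : ℂ)) := by
    intro z
    rw [Finset.prod_mul_distrib, prod_comp_eq_prod_pow i z,
      prod_comp_eq_prod_pow j (fun x => star (z x)), Finset.prod_mul_distrib,
      Finset.prod_mul_distrib, ← Finset.sum_neg_distrib, Real.exp_sum]
    push_cast
    rfl
  simp only [h1]
  rw [integral_prod_pow_mul_conj_pow_mul_exp
    (fun x => Fintype.card {t // i t = x}) (fun x => Fintype.card {t // j t = x}),
    card_perm_comp_eq]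
  split_ifs <;> simp

theorem integral_Ioi_pow_mul_exp_neg_sq (k : ℕ) (hk : 0 < k) :
    ∫ r in Set.Ioi (0 : ℝ), r ^ (2 * k - 1) * Real.exp (-r ^ 2) = ((k - 1).factorial : ℝ) / 2 := by
  obtain ⟨k, rfl⟩ := Nat.exists_eq_add_one.mpr hk
  have h := integral_rpow_mul_exp_neg_rpow (p := 2) (q := ((2 * (k + 1) - 1 : ℕ) : ℝ)) (by norm_num)
    (by linarith [Nat.cast_nonneg (α := ℝ) (2 * (k + 1) - 1)])
  simp only [Real.rpow_natCast, Real.rpow_two] at h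
  rw [h, show 2 * (k + 1) - 1 = 2 * k + 1 by omega,
    show ((((2 * k + 1 : ℕ) : ℝ) + 1) / 2) = k + 1 by push_cast; ring, Real.Gamma_nat_eq_factorial]
  simp
  ring

/-- Polar coordinates for a Gaussian integral of a function that is homogeneous of degree `k`. -/
theorem integral_homogeneous_mul_exp {E : Type*} [NormedAddCommGroup E] [NormedSpace ℝ E]
    [MeasurableSpace E] [BorelSpace E] [FiniteDimensional ℝ E] [Nontrivial E] (μ : Measure E)
    [μ.IsAddHaarMeasure] (k : ℕ) (f : E → ℂ)
    (hf : ∀ (r : ℝ) (x : E), 0 < r → f (r • x) = r ^ k * f x) :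
    ∫ x, f x * (Real.exp (-‖x‖ ^ 2) : ℂ) ∂μ =
      (∫ s, f s.1 ∂μ.toSphere) *
        ((∫ r in Set.Ioi (0 : ℝ),
          r ^ (Module.finrank ℝ E - 1 + k) * Real.exp (-r ^ 2) : ℝ) : ℂ) := by
  have h1 : ∫ x, f x * (Real.exp (-‖x‖ ^ 2) : ℂ) ∂μ =
      ∫ x : ({(0)}ᶜ : Set E), f x.1 * (Real.exp (-‖x.1‖ ^ 2) : ℂ) ∂(μ.comap (↑)) := by
    rw [integral_subtype_comap (measurableSet_singleton _).compl
      fun x => f x * (Real.exp (-‖x‖ ^ 2) : ℂ), restrict_compl_singleton]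
  have h2 : ∀ x : ({(0)}ᶜ : Set E), f x.1 * (Real.exp (-‖x.1‖ ^ 2) : ℂ) =
      (fun p : Metric.sphere (0 : E) 1 × Set.Ioi (0 : ℝ) =>
        f p.1.1 * ((p.2.1 ^ k * Real.exp (-p.2.1 ^ 2) : ℝ) : ℂ))
          (homeomorphUnitSphereProd E x) := by
    intro x
    have hx : 0 < ‖x.1‖ := norm_pos_iff.mpr x.2
    have h3 : x.1 = ‖x.1‖ • (‖x.1‖⁻¹ • x.1) := by
      rw [smul_smul, mul_inv_cancel₀ hx.ne', one_smul]
    conv_lhs => rw [h3, hf _ _ hx, ← h3]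
    simp only [homeomorphUnitSphereProd_apply_fst_coe, homeomorphUnitSphereProd_apply_snd_coe]
    push_cast
    ring
  simp only [h1, h2]
  rw [μ.measurePreserving_homeomorphUnitSphereProd.integral_comp
    (Homeomorph.measurableEmbedding _) (fun p : Metric.sphere (0 : E) 1 × Set.Ioi (0 : ℝ) =>
        f p.1.1 * ((p.2.1 ^ k * Real.exp (-p.2.1 ^ 2) : ℝ) : ℂ)),
    integral_prod_mul (fun s : Metric.sphere (0 : E) 1 => f s.1)
      (fun r : Set.Ioi (0 : ℝ) => ((r.1 ^ k * Real.exp (-r.1 ^ 2) : ℝ) : ℂ)),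
    integral_complex_ofReal]
  congr 2
  simp only [Measure.volumeIoiPow, ENNReal.ofReal]
  rw [integral_withDensity_eq_integral_smul (measurable_subtype_coe.pow_const _).real_toNNReal,
    integral_subtype_comap measurableSet_Ioi
      fun a => Real.toNNReal (a ^ (Module.finrank ℝ E - 1)) • (a ^ k * Real.exp (-a ^ 2))]
  refine setIntegral_congr_fun measurableSet_Ioi fun x hx => ?_
  simp only [NNReal.smul_def, Real.coe_toNNReal _ (pow_nonneg (le_of_lt hx) _), smul_eq_mul]
  ring

/-- Lebesgue measure on `ℂ^ι` with its Euclidean norm is proportional to the product measure. -/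
theorem exists_integral_euclideanSpace_eq (ι : Type*) [Fintype ι] :
    ∃ c : ℂ, ∀ f : EuclideanSpace ℂ ι → ℂ,
      ∫ x, f x = c * ∫ z : ι → ℂ, f (WithLp.toLp 2 z) := by
  let e := (EuclideanSpace.equiv ι ℂ).symm
  have : ((volume : Measure (ι → ℂ)).map e).IsAddHaarMeasure :=
    e.isAddHaarMeasure_map volume
  have h := Measure.isAddLeftInvariant_eq_smul (volume : Measure (EuclideanSpace ℂ ι))
    ((volume : Measure (ι → ℂ)).map e)
  refine ⟨(Measure.addHaarScalarFactor (volume : Measure (EuclideanSpace ℂ ι))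
    ((volume : Measure (ι → ℂ)).map e) : ℝ), fun f => ?_⟩
  conv_lhs => rw [h]
  have hmap : ∫ x, f x ∂(volume : Measure (ι → ℂ)).map e = ∫ z, f (e z) :=
    e.toHomeomorph.measurableEmbedding.integral_map f
  rw [integral_smul_nnreal_measure, hmap, NNReal.smul_def, Complex.real_smul]
  rfl

/-- The moments of the uniform measure on the unit sphere of `ℂ^ι`. -/
theorem integral_sphere_prod_mul_conj {ι : Type*} [Fintype ι] [DecidableEq ι] [Nonempty ι] {n : ℕ}
    (i j : Fin n → ι) :
    ∫ ψ, (∏ t, ψ.1 (i t) * star (ψ.1 (j t))) ∂(sphereMeasure ι) =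
      ((Fintype.card ι - 1).factorial : ℂ) / ((n + Fintype.card ι - 1).factorial : ℂ) *
        Fintype.card {π : Equiv.Perm (Fin n) // i = j ∘ π} := by
  set m := Fintype.card ι with hm
  have hm0 : 0 < m := Fintype.card_pos
  set ν := (volume : Measure (EuclideanSpace ℂ ι)).toSphere with hν
  obtain ⟨c, hc⟩ := exists_integral_euclideanSpace_eq ι
  have hfin : Module.finrank ℝ (EuclideanSpace ℂ ι) = 2 * m := by
    rw [← Module.finrank_mul_finrank ℝ ℂ, finrank_euclideanSpace, Complex.finrank_real_complex]
  have key : ∀ (k : ℕ) (i j : Fin k → ι),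
      c * ((Real.pi : ℂ) ^ m * Fintype.card {π : Equiv.Perm (Fin k) // i = j ∘ π}) =
      (∫ ψ, (∏ t, ψ.1 (i t) * star (ψ.1 (j t))) ∂ν) * (((k + m - 1).factorial : ℂ) / 2) := by
    intro k i j
    rw [← integral_prod_mul_conj_mul_exp]
    have h1 := integral_homogeneous_mul_exp (volume : Measure (EuclideanSpace ℂ ι)) (2 * k)
      (fun x => ∏ t, x (i t) * star (x (j t))) (by
        intro r x _
        have : ∀ t, (r • x) (i t) * star ((r • x) (j t)) =
            (r : ℂ) ^ 2 * (x (i t) * star (x (j t))) := by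
          intro t
          simp
          ring
        simp only [this]
        rw [Finset.prod_mul_distrib, Finset.prod_const, Finset.card_univ,
          Fintype.card_fin, pow_mul])
    rw [hc, hfin, show 2 * m - 1 + 2 * k = 2 * (k + m) - 1 by omega,
      integral_Ioi_pow_mul_exp_neg_sq (k + m) (by omega)] at h1
    simp only [EuclideanSpace.norm_sq_eq] at h1
    push_cast at h1 ⊢
    exact h1
  have hS : (ν.real Set.univ : ℂ) ≠ 0 := by
    have : (Metric.sphere (0 : EuclideanSpace ℂ ι) 1).Nonempty :=
      NormedSpace.sphere_nonempty.mpr zero_le_one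
    have : Nonempty (Metric.sphere (0 : EuclideanSpace ℂ ι) 1) := this.to_subtype
    exact_mod_cast (measureReal_ne_zero_iff).mpr (isOpen_univ.measure_ne_zero ν Set.univ_nonempty)
  -- the case of no factors determines the unknown constant `c`
  have h0 := key 0 Fin.elim0 Fin.elim0
  have hn := key n i j
  have hone : Fintype.card
      {π : Equiv.Perm (Fin 0) // (Fin.elim0 : Fin 0 → ι) = Fin.elim0 ∘ π} = 1 := by
    rw [Fintype.card_eq_one_iff]
    exact ⟨⟨1, Subsingleton.elim _ _⟩, fun _ => Subsingleton.elim _ _⟩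
  simp only [hone, Finset.univ_eq_empty, Finset.prod_empty, integral_const, zero_add] at h0
  simp only [Complex.real_smul, mul_one, Nat.cast_one] at h0
  have h2 : ∫ ψ, (∏ t, ψ.1 (i t) * star (ψ.1 (j t))) ∂(sphereMeasure ι) =
      (ν.real Set.univ : ℂ)⁻¹ * ∫ ψ, (∏ t, ψ.1 (i t) * star (ψ.1 (j t))) ∂ν := by
    rw [sphereMeasure, integral_smul_measure, Complex.real_smul, ENNReal.toReal_inv]
    push_cast
    rfl
  rw [h2]
  have hf : ((n + m - 1).factorial : ℂ) ≠ 0 := by exact_mod_cast Nat.factorial_ne_zero _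
  rw [← mul_assoc, h0] at hn
  field_simp
  linear_combination (-2) * hn

/-! ### The resolution of the identity on the symmetric subspace -/

/-- `(n + m - 1)! / (n! (m - 1)!)`, the dimension of the symmetric subspace of `(ℂ^m)^{⊗n}`, for
`m ≥ 1`. -/
def symDim (m n : ℕ) : ℕ := (n + m - 1).choose n

theorem symDim_le (m n : ℕ) (hm : 0 < m) : symDim m n ≤ (n + 1) ^ m := by
  obtain ⟨m, rfl⟩ := Nat.exists_eq_add_one.mpr hm
  clear hm
  suffices h : symDim (m + 1) n ≤ (n + 1) ^ m from
    h.trans (Nat.pow_le_pow_right (by omega) (by omega))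
  simp only [symDim, ← add_assoc, Nat.add_sub_cancel]
  induction m with
  | zero => simp
  | succ m ih =>
    have h := Nat.add_one_mul_choose_eq (n + m) m
    have h1 : (n + m).choose n = (n + m).choose m := Nat.choose_symm_add
    have h2 : (n + (m + 1)).choose n = (n + (m + 1)).choose (m + 1) := Nat.choose_symm_add
    rw [h2, pow_succ]
    rw [h1] at ih
    refine Nat.le_of_mul_le_mul_right ?_ (show 0 < m + 1 from m.succ_pos)
    have h3 : (n + (m + 1)).choose (m + 1) * (m + 1) = (n + m + 1) * (n + m).choose m := h.symm
    rw [h3]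
    calc (n + m + 1) * (n + m).choose m ≤ ((n + 1) * (m + 1)) * (n + 1) ^ m := by
          gcongr; nlinarith
      _ = _ := by ring

/-- The symmetric tensor power `ψ^{⊗n}` in coordinates. -/
def vecPow {ι : Type*} (n : ℕ) (ψ : ι → ℂ) : (Fin n → ι) → ℂ := fun i => ∏ t, ψ (i t)

/-- On symmetric vectors `φ`, the average `∫ |ψ⟩⟨ψ|^{⊗n} dψ` acts as the inverse of the dimension
of the symmetric subspace. -/
theorem sum_integral_mul_of_symmetric {ι : Type*} [Fintype ι] [DecidableEq ι] [Nonempty ι] {n : ℕ}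
    (φ : (Fin n → ι) → ℂ) (hφ : ∀ (π : Equiv.Perm (Fin n)) i, φ (i ∘ π) = φ i) (i : Fin n → ι) :
    (symDim (Fintype.card ι) n : ℂ) *
      ∑ j, (∫ ψ, vecPow n ψ.1 i * star (vecPow n ψ.1 j) ∂(sphereMeasure ι)) * φ j = φ i := by
  have h1 : ∀ j : Fin n → ι, (∫ ψ, vecPow n ψ.1 i * star (vecPow n ψ.1 j) ∂(sphereMeasure ι)) =
      ((Fintype.card ι - 1).factorial : ℂ) / ((n + Fintype.card ι - 1).factorial : ℂ) *
        Fintype.card {π : Equiv.Perm (Fin n) // i = j ∘ π} := by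
    intro j
    rw [← integral_sphere_prod_mul_conj]
    simp only [vecPow, star_prod, Finset.prod_mul_distrib]
  have h2 : ∑ j, (Fintype.card {π : Equiv.Perm (Fin n) // i = j ∘ π} : ℂ) * φ j =
      (n.factorial : ℂ) * φ i := by
    have h3 : ∀ j : Fin n → ι, (Fintype.card {π : Equiv.Perm (Fin n) // i = j ∘ π} : ℂ) * φ j =
        ∑ π : Equiv.Perm (Fin n), if i = j ∘ π then φ i else 0 := by
      intro j
      rw [Fintype.card_subtype, Finset.card_filter, Nat.cast_sum, Finset.sum_mul]
      refine Finset.sum_congr rfl fun π _ => ?_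
      split_ifs with h
      · rw [h, hφ]; simp
      · simp
    simp only [h3]
    rw [Finset.sum_comm]
    have h4 : ∀ π : Equiv.Perm (Fin n),
        (∑ j : Fin n → ι, if i = j ∘ π then φ i else 0) = φ i := by
      intro π
      rw [Finset.sum_eq_single (i ∘ π.symm)]
      · simp [Function.comp_assoc]
      · intro j _ hj
        rw [if_neg]
        rintro rfl
        exact hj (by simp [Function.comp_assoc])
      · simp
    simp only [h4]
    simp [Fintype.card_perm]
  simp only [h1, mul_assoc]
  rw [← Finset.mul_sum, h2]
  have hm : 0 < Fintype.card ι := Fintype.card_pos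
  have h5 := Nat.choose_mul_factorial_mul_factorial
    (show n ≤ n + Fintype.card ι - 1 by omega)
  rw [show n + Fintype.card ι - 1 - n = Fintype.card ι - 1 by omega] at h5
  have hf : ((n + Fintype.card ι - 1).factorial : ℂ) ≠ 0 := by
    exact_mod_cast Nat.factorial_ne_zero _
  have h6 : (symDim (Fintype.card ι) n : ℂ) * n.factorial * (Fintype.card ι - 1).factorial =
      (n + Fintype.card ι - 1).factorial := by exact_mod_cast h5
  field_simp
  linear_combination (φ i) * h6

/-! ### Polar decomposition and the fidelity -/

/-- Polar decomposition: if `R R† = P²` with `P ≥ 0`, then `R = P V` for the contraction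
`V = P⁺ R`, where `P⁺` is the pseudo-inverse of `P`. Moreover `V V†` is the projection onto the
range of `P`, which gives `R V† = P`. -/
theorem exists_polar {κ γ : Type*} [Fintype κ] [DecidableEq κ] [Fintype γ] [DecidableEq γ]
    (P : Matrix κ κ ℂ) (hP : 0 ≤ P) (R : Matrix κ γ ℂ) (h : R * Rᴴ = P * P) :
    ∃ V : Matrix κ γ ℂ, ‖V‖ ≤ 1 ∧ P * V = R ∧ R * Vᴴ = P := by
  have hsa : IsSelfAdjoint P := hP.isSelfAdjoint
  -- the convention `0⁻¹ = 0` makes this functional calculus the pseudo-inverse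
  set Q : Matrix κ κ ℂ := cfc (fun x : ℝ => x⁻¹) P with hQ
  -- the spectrum is finite, so every function is continuous on it
  have hc : ∀ f : ℝ → ℝ, ContinuousOn f (spectrum ℝ P) := fun f =>
    (Matrix.finite_real_spectrum (A := P)).continuousOn f
  have hQsa : Qᴴ = Q := (IsSelfAdjoint.cfc (f := fun x : ℝ => x⁻¹) (a := P))
  have hid : cfc (fun x : ℝ => x) P = P := cfc_id' ℝ P
  have hPQ : P * Q = cfc (fun x : ℝ => x * x⁻¹) P := by
    rw [cfc_mul _ _ P (hc _) (hc _), hid]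
  have hQP : Q * P = P * Q := by
    rw [hPQ]
    simp only [mul_comm _ (_ : ℝ)⁻¹]
    rw [cfc_mul _ _ P (hc _) (hc _), hid]
  have hPQP : P * Q * P = P := by
    have h1 : cfc (fun x : ℝ => x * x⁻¹ * x) P = P := by
      conv_rhs => rw [← hid]
      congr 1
      funext x
      simp
    rw [cfc_mul _ _ P (hc _) (hc _), hid] at h1
    rw [hPQ, h1]
  have hQPQ : Q * P * Q = Q := by
    rw [hQP, hPQ, hQ, ← cfc_mul _ _ P (hc _) (hc _)]
    congr 1
    funext x
    by_cases hx : x = 0 <;> simp [hx]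
  have hPsa : Pᴴ = P := hsa
  have hVV : Q * R * (Q * R)ᴴ = P * Q := by
    rw [conjTranspose_mul, hQsa, Matrix.mul_assoc, ← Matrix.mul_assoc R, h, ← Matrix.mul_assoc,
      ← Matrix.mul_assoc, hQP, hPQP]
  have hER : P * (Q * R) = R := by
    have h1 : (P * (Q * R) - R) * (P * (Q * R) - R)ᴴ = 0 := by
      have h2 : P * (Q * R) - R = (P * Q - 1) * R := by
        rw [Matrix.sub_mul, Matrix.one_mul, Matrix.mul_assoc]
      rw [h2, conjTranspose_mul, Matrix.mul_assoc, ← Matrix.mul_assoc R, h, ← Matrix.mul_assoc,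
        ← Matrix.mul_assoc, Matrix.sub_mul, Matrix.one_mul, hPQP, sub_self, Matrix.zero_mul,
        Matrix.zero_mul]
    exact sub_eq_zero.mp (self_mul_conjTranspose_eq_zero.mp h1)
  refine ⟨Q * R, ?_, hER, ?_⟩
  · have h1 : ‖Q * R‖ * ‖Q * R‖ = ‖P * Q‖ := by
      rw [← hVV, ← l2_opNorm_conjTranspose (Q * R), ← l2_opNorm_conjTranspose_mul_self,
        conjTranspose_conjTranspose]
    have h2 : ‖P * Q‖ * ‖P * Q‖ = ‖P * Q‖ := by
      rw [← l2_opNorm_conjTranspose_mul_self, conjTranspose_mul, hPsa, hQsa, ← Matrix.mul_assoc,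
        hQP, hPQP]
    have h3 : ‖P * Q‖ ≤ 1 := by nlinarith [norm_nonneg (P * Q)]
    nlinarith [norm_nonneg (Q * R)]
  · rw [conjTranspose_mul, hQsa, ← Matrix.mul_assoc, h, Matrix.mul_assoc, ← hQP,
      ← Matrix.mul_assoc, hPQP]

/-- A Cauchy–Schwarz bound for the Hilbert–Schmidt inner product of `A†` and `C B`, with the
geometric mean of the two norms replaced by the arithmetic mean. -/
theorem norm_trace_mul_mul_le {α β γ : Type*} [Fintype α] [DecidableEq α] [Fintype β]
    [DecidableEq β] [Fintype γ] (A : Matrix γ α ℂ) (C : Matrix α β ℂ)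
    (B : Matrix β γ ℂ) :
    ‖(A * C * B).trace‖ ≤ ‖C‖ * (((A * Aᴴ).trace.re + (Bᴴ * B).trace.re) / 2) := by
  let a : γ → EuclideanSpace ℂ α := fun i => WithLp.toLp 2 (star (A i))
  let b : γ → EuclideanSpace ℂ β := fun i => WithLp.toLp 2 (fun k => B k i)
  have h1 : (A * C * B).trace = ∑ i, inner ℂ (a i) (WithLp.toLp 2 (C *ᵥ (b i).ofLp)) := by
    rw [Matrix.mul_assoc]
    simp only [Matrix.trace, Matrix.diag, Matrix.mul_apply, a, b,
      EuclideanSpace.inner_eq_star_dotProduct, dotProduct, mulVec]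
    refine Finset.sum_congr rfl fun i _ => Finset.sum_congr rfl fun j _ => ?_
    simp [mul_comm]
  have h2 : (A * Aᴴ).trace.re = ∑ i, ‖a i‖ ^ 2 := by
    simp only [Matrix.trace, Matrix.diag, Matrix.mul_apply, a, EuclideanSpace.norm_sq_eq,
      conjTranspose_apply, Complex.re_sum]
    refine Finset.sum_congr rfl fun i _ => Finset.sum_congr rfl fun j _ => ?_
    rw [show A i j * star (A i j) = ((‖A i j‖ ^ 2 : ℝ) : ℂ) by simpa using Complex.mul_conj' _]
    simp [-Complex.ofReal_pow]
  have h3 : (Bᴴ * B).trace.re = ∑ i, ‖b i‖ ^ 2 := by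
    simp only [Matrix.trace, Matrix.diag, Matrix.mul_apply, b, EuclideanSpace.norm_sq_eq,
      conjTranspose_apply, Complex.re_sum]
    refine Finset.sum_congr rfl fun i _ => Finset.sum_congr rfl fun j _ => ?_
    rw [show star (B j i) * (B j i) = ((‖B j i‖ ^ 2 : ℝ) : ℂ) by simpa using Complex.conj_mul' _]
    simp [-Complex.ofReal_pow]
  rw [h1, h2, h3, ← Finset.sum_add_distrib, Finset.sum_div, Finset.mul_sum]
  refine (norm_sum_le _ _).trans (Finset.sum_le_sum fun i _ => ?_)
  have h4 : ‖WithLp.toLp 2 (C *ᵥ (b i).ofLp)‖ ≤ ‖C‖ * ‖b i‖ := l2_opNorm_mulVec C (b i)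
  calc ‖inner ℂ (a i) (WithLp.toLp 2 (C *ᵥ (b i).ofLp))‖
      ≤ ‖a i‖ * ‖WithLp.toLp 2 (C *ᵥ (b i).ofLp)‖ := norm_inner_le_norm _ _
    _ ≤ ‖a i‖ * (‖C‖ * ‖b i‖) := by gcongr
    _ = ‖C‖ * (‖a i‖ * ‖b i‖) := by ring
    _ ≤ ‖C‖ * ((‖a i‖ ^ 2 + ‖b i‖ ^ 2) / 2) := by
        gcongr
        nlinarith [sq_nonneg (‖a i‖ - ‖b i‖)]

/-- Polar decomposition `M = Y |M|` of a square matrix. -/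
theorem exists_abs_polar {κ : Type*} [Fintype κ] [DecidableEq κ] (M : Matrix κ κ ℂ) :
    ∃ Y : Matrix κ κ ℂ, ‖Y‖ ≤ 1 ∧ M = Y * CFC.abs M ∧ CFC.abs M = Mᴴ * Y := by
  have h0 : (CFC.abs M)ᴴ = CFC.abs M := (CFC.abs_nonneg M).isSelfAdjoint
  obtain ⟨V, h1, h2, h3⟩ := exists_polar (CFC.abs M) (CFC.abs_nonneg M) Mᴴ (by
    rw [conjTranspose_conjTranspose, CFC.abs_mul_abs]; rfl)
  refine ⟨Vᴴ, by rwa [l2_opNorm_conjTranspose], ?_, h3.symm⟩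
  have := congrArg conjTranspose h2
  rwa [conjTranspose_conjTranspose, conjTranspose_mul, h0, eq_comm] at this

theorem posSemidef_sqrt_mul_self {κ : Type*} [Fintype κ] [DecidableEq κ] {A : Matrix κ κ ℂ}
    (hA : A.PosSemidef) : CFC.sqrt A * CFC.sqrt A = A :=
  CFC.sqrt_mul_sqrt_self A hA.nonneg

theorem conjTranspose_sqrt {κ : Type*} [Fintype κ] [DecidableEq κ] (A : Matrix κ κ ℂ) :
    (CFC.sqrt A)ᴴ = CFC.sqrt A := (CFC.sqrt_nonneg A).isSelfAdjoint

/-- Duality of the trace norm and the operator norm. -/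
theorem norm_trace_mul_le_traceNorm {κ : Type*} [Fintype κ] [DecidableEq κ] (C M : Matrix κ κ ℂ) :
    ‖(C * M).trace‖ ≤ ‖C‖ * traceNorm M := by
  obtain ⟨Y, hY, hM, -⟩ := exists_abs_polar M
  set T := CFC.abs M with hT
  have hT0 : T.PosSemidef := (CFC.abs_nonneg M).posSemidef
  have hS := posSemidef_sqrt_mul_self hT0
  set S := CFC.sqrt T with hSdef
  have hSs : Sᴴ = S := conjTranspose_sqrt T
  have h1 : (C * M).trace = (S * (C * Y) * S).trace := by
    rw [hM, ← hS, Matrix.trace_mul_comm (S * (C * Y)), ← Matrix.mul_assoc, ← Matrix.mul_assoc,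
      ← Matrix.mul_assoc, Matrix.trace_mul_comm (S * S), Matrix.mul_assoc (C * Y), Matrix.mul_assoc]
  rw [h1]
  refine (norm_trace_mul_mul_le _ _ _).trans ?_
  rw [hSs, hS, traceNorm, ← hT, add_self_div_two]
  have h2 : 0 ≤ T.trace.re := (Complex.nonneg_iff.mp hT0.trace_nonneg).1
  gcongr
  calc ‖C * Y‖ ≤ ‖C‖ * ‖Y‖ := l2_opNorm_mul _ _
    _ ≤ ‖C‖ * 1 := by gcongr
    _ = ‖C‖ := mul_one _

/-- The easy half of Uhlmann's theorem: the overlap of two purifications `R`, `S` is at most the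
fidelity of the states `R R†`, `S S†`. -/
theorem norm_trace_conjTranspose_mul_le_fidelity {κ γ : Type*} [Fintype κ] [DecidableEq κ]
    [Fintype γ] [DecidableEq γ] (R S : Matrix κ γ ℂ) :
    ‖(Rᴴ * S).trace‖ ≤ fidelity (R * Rᴴ) (S * Sᴴ) := by
  obtain ⟨V, hV, hR, -⟩ := exists_polar (CFC.sqrt (R * Rᴴ)) (CFC.sqrt_nonneg _) R
    (posSemidef_sqrt_mul_self (posSemidef_self_mul_conjTranspose R)).symm
  obtain ⟨W, hW, hS, -⟩ := exists_polar (CFC.sqrt (S * Sᴴ)) (CFC.sqrt_nonneg _) S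
    (posSemidef_sqrt_mul_self (posSemidef_self_mul_conjTranspose S)).symm
  rw [fidelity]
  set P := CFC.sqrt (R * Rᴴ) with hP
  set Q := CFC.sqrt (S * Sᴴ) with hQ
  have hPs : Pᴴ = P := conjTranspose_sqrt _
  have h1 : (Rᴴ * S).trace = ((W * Vᴴ) * (P * Q)).trace := by
    conv_lhs => rw [← hR, ← hS]
    rw [conjTranspose_mul, hPs, Matrix.mul_assoc W, Matrix.trace_mul_comm W]
    simp only [Matrix.mul_assoc]
  rw [h1]
  refine (norm_trace_mul_le_traceNorm _ _).trans ?_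
  have h2 : ‖W * Vᴴ‖ ≤ 1 := by
    refine (l2_opNorm_mul _ _).trans ?_
    rw [l2_opNorm_conjTranspose]
    exact mul_le_one₀ hW (norm_nonneg _) hV
  have h3 : 0 ≤ traceNorm (P * Q) :=
    (Complex.nonneg_iff.mp (CFC.abs_nonneg (P * Q)).posSemidef.trace_nonneg).1
  exact mul_le_of_le_one_left h3 h2

theorem fidelity_nonneg {κ : Type*} [Fintype κ] [DecidableEq κ] (A B : Matrix κ κ ℂ) :
    0 ≤ fidelity A B :=
  (Complex.nonneg_iff.mp (CFC.abs_nonneg _).posSemidef.trace_nonneg).1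

theorem fidelity_le_one {κ : Type*} [Fintype κ] [DecidableEq κ] {A B : Matrix κ κ ℂ}
    (hA : A.PosSemidef) (hB : B.PosSemidef) (hA1 : A.trace = 1) (hB1 : B.trace = 1) :
    fidelity A B ≤ 1 := by
  rw [fidelity, traceNorm]
  obtain ⟨Y, hY, -, hM⟩ := exists_abs_polar (CFC.sqrt A * CFC.sqrt B)
  rw [hM, conjTranspose_mul, conjTranspose_sqrt, conjTranspose_sqrt, Matrix.mul_assoc,
    Matrix.trace_mul_comm]
  refine (Complex.re_le_norm _).trans ((norm_trace_mul_mul_le _ _ _).trans ?_)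
  rw [conjTranspose_sqrt, conjTranspose_sqrt, posSemidef_sqrt_mul_self hA,
    posSemidef_sqrt_mul_self hB, hA1, hB1]
  norm_num
  exact hY

theorem continuousOn_fidelity_right {κ : Type*} [Fintype κ] [DecidableEq κ] (A : Matrix κ κ ℂ) :
    ContinuousOn (fidelity A) {B | 0 ≤ B} := by
  have h1 : ContinuousOn (CFC.sqrt : Matrix κ κ ℂ → Matrix κ κ ℂ) {B | 0 ≤ B} :=
    CFC.continuousOn_sqrt
  have h2 : Continuous (CFC.abs : Matrix κ κ ℂ → Matrix κ κ ℂ) := CFC.continuous_abs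
  have h3 : Continuous (fun X : Matrix κ κ ℂ => X.trace.re) :=
    Complex.continuous_re.comp (Continuous.matrix_trace continuous_id)
  exact (h3.comp h2).comp_continuousOn (continuousOn_const.mul h1)

/-! ### Tensor powers -/

theorem tensorPow_mul {ι : Type*} [Fintype ι] [DecidableEq ι] (n : ℕ) (A B : Matrix ι ι ℂ) :
    tensorPow n A * tensorPow n B = tensorPow n (A * B) := by
  ext i j
  simp only [tensorPow, tensorProd, Matrix.mul_apply, Matrix.of_apply, Finset.prod_univ_sum,
    Fintype.piFinset_univ, Finset.prod_mul_distrib]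

theorem conjTranspose_tensorPow {ι : Type*} (n : ℕ) (A : Matrix ι ι ℂ) :
    (tensorPow n A)ᴴ = tensorPow n Aᴴ := by
  ext i j
  simp [tensorPow, tensorProd, conjTranspose_apply]

theorem trace_tensorPow {ι : Type*} [Fintype ι] [DecidableEq ι] (n : ℕ) (A : Matrix ι ι ℂ) :
    (tensorPow n A).trace = A.trace ^ n := by
  simp only [tensorPow, tensorProd, Matrix.trace, Matrix.diag, Matrix.of_apply]
  rw [← Fin.prod_const, Finset.prod_univ_sum, Fintype.piFinset_univ]

theorem posSemidef_tensorPow {ι : Type*} [Fintype ι] [DecidableEq ι] (n : ℕ) {A : Matrix ι ι ℂ}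
    (hA : A.PosSemidef) : (tensorPow n A).PosSemidef := by
  have h : tensorPow n A = (tensorPow n (CFC.sqrt A))ᴴ * tensorPow n (CFC.sqrt A) := by
    rw [conjTranspose_tensorPow, tensorPow_mul, conjTranspose_sqrt, posSemidef_sqrt_mul_self hA]
  rw [h]
  exact posSemidef_conjTranspose_mul_self _

theorem sqrt_tensorPow {ι : Type*} [Fintype ι] [DecidableEq ι] (n : ℕ) {A : Matrix ι ι ℂ}
    (hA : A.PosSemidef) : CFC.sqrt (tensorPow n A) = tensorPow n (CFC.sqrt A) :=
  CFC.sqrt_unique (by rw [tensorPow_mul, posSemidef_sqrt_mul_self hA])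
    (posSemidef_tensorPow n (CFC.sqrt_nonneg A).posSemidef).nonneg

/-- Square roots and absolute values commute with tensor powers, and the trace turns them into
powers. -/
theorem fidelity_tensorPow {ι : Type*} [Fintype ι] [DecidableEq ι] (n : ℕ) {A B : Matrix ι ι ℂ}
    (hA : A.PosSemidef) (hB : B.PosSemidef) :
    fidelity (tensorPow n A) (tensorPow n B) = fidelity A B ^ n := by
  have h : ∀ M : Matrix ι ι ℂ, CFC.abs (tensorPow n M) = tensorPow n (CFC.abs M) := by
    intro M
    rw [CFC.abs, CFC.abs, star_eq_conjTranspose, star_eq_conjTranspose, conjTranspose_tensorPow,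
      tensorPow_mul, sqrt_tensorPow n (posSemidef_conjTranspose_mul_self M)]
  rw [fidelity, fidelity, traceNorm, traceNorm, sqrt_tensorPow n hA, sqrt_tensorPow n hB,
    tensorPow_mul, h, trace_tensorPow]
  have h1 : ((CFC.abs (CFC.sqrt A * CFC.sqrt B)).trace.re : ℂ) =
      (CFC.abs (CFC.sqrt A * CFC.sqrt B)).trace :=
    Complex.ext rfl (Complex.nonneg_iff.mp (CFC.abs_nonneg _).posSemidef.trace_nonneg).2
  rw [← h1, ← Complex.ofReal_pow, Complex.ofReal_re, Complex.ofReal_re]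

/-! ### Kraus operators and monotonicity of the fidelity -/

/-- `K` is a family of Kraus operators of the trace-preserving map `N`. -/
structure IsKraus {α ι κ : Type*} [Fintype α] [Fintype ι] [DecidableEq ι] [Fintype κ]
    (K : α → Matrix κ ι ℂ) (N : Matrix ι ι ℂ →ₗ[ℂ] Matrix κ κ ℂ) : Prop where
  map_eq : ∀ X, N X = ∑ a, K a * X * (K a)ᴴ
  sum_eq_one : ∑ a, (K a)ᴴ * K a = 1

/-- Monotonicity of the fidelity under channels: the overlap of purifications `A`, `B` of two
inputs bounds the fidelity of the outputs from below. -/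
theorem IsKraus.norm_trace_le_fidelity {α ι κ γ : Type*} [Fintype α] [DecidableEq α] [Fintype ι]
    [DecidableEq ι] [Fintype κ] [DecidableEq κ] [Fintype γ] [DecidableEq γ]
    {K : α → Matrix κ ι ℂ} {N : Matrix ι ι ℂ →ₗ[ℂ] Matrix κ κ ℂ} (h : IsKraus K N)
    (A B : Matrix ι γ ℂ) : ‖(Aᴴ * B).trace‖ ≤ fidelity (N (A * Aᴴ)) (N (B * Bᴴ)) := by
  -- `S A` is the image of the purification `A` under the Stinespring isometry `∑ K a ⊗ |a⟩`
  let S : Matrix ι γ ℂ → Matrix κ (α × γ) ℂ := fun A => Matrix.of fun k p => (K p.1 * A) k p.2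
  have h1 : ∀ A, S A * (S A)ᴴ = N (A * Aᴴ) := by
    intro A
    rw [h.map_eq]
    ext k l
    rw [Matrix.mul_apply, Fintype.sum_prod_type, Matrix.sum_apply]
    refine Finset.sum_congr rfl fun a _ => ?_
    rw [show K a * (A * Aᴴ) * (K a)ᴴ = (K a * A) * (K a * A)ᴴ by
      rw [conjTranspose_mul]; simp only [Matrix.mul_assoc], Matrix.mul_apply]
    rfl
  have h2 : (S A)ᴴ * S B = Matrix.of fun p q : α × γ => ((K p.1 * A)ᴴ * (K q.1 * B)) p.2 q.2 := by
    ext p q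
    rfl
  have h3 : ((S A)ᴴ * S B).trace = (Aᴴ * B).trace := by
    rw [h2]
    simp only [Matrix.trace, Matrix.diag, Matrix.of_apply]
    rw [Fintype.sum_prod_type, Finset.sum_comm]
    refine Finset.sum_congr rfl fun g _ => ?_
    rw [← Matrix.sum_apply]
    have h4 : ∑ a, (K a * A)ᴴ * (K a * B) = Aᴴ * B := by
      calc ∑ a, (K a * A)ᴴ * (K a * B) = Aᴴ * ((∑ a, (K a)ᴴ * K a) * B) := by
            rw [Matrix.sum_mul, Matrix.mul_sum]
            simp only [conjTranspose_mul, Matrix.mul_assoc]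
        _ = Aᴴ * B := by rw [h.sum_eq_one, Matrix.one_mul]
    exact congrFun (congrFun h4 g) g
  rw [← h3, ← h1, ← h1]
  exact norm_trace_conjTranspose_mul_le_fidelity _ _

/-- The tensor products of the Kraus operators of `N` are Kraus operators of `N^{⊗n}`. -/
theorem IsKraus.tensorPowMap {α ι κ : Type*} [Fintype α] [DecidableEq α] [Fintype ι]
    [DecidableEq ι] [Fintype κ] [DecidableEq κ] {K : α → Matrix κ ι ℂ}
    {N : Matrix ι ι ℂ →ₗ[ℂ] Matrix κ κ ℂ} (h : IsKraus K N) (n : ℕ) :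
    IsKraus (fun a : Fin n → α => Matrix.of fun (k : Fin n → κ) (i : Fin n → ι) =>
      ∏ t, K (a t) (k t) (i t)) (DeFinetti.tensorPowMap n N) where
  map_eq X := by
    ext k l
    have h1 : ∀ i j k l, N (Matrix.single i j 1) k l = ∑ a, K a k i * star (K a l j) := by
      intro i j k l
      rw [h.map_eq, Matrix.sum_apply]
      refine Finset.sum_congr rfl fun a _ => ?_
      rw [Matrix.mul_apply, Finset.sum_eq_single j]
      · simp
      · intro b _ hb
        simp [Matrix.mul_single_apply_of_ne, hb]
      · simp
    simp only [DeFinetti.tensorPowMap, tensorProd, LinearMap.coe_mk, AddHom.coe_mk,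
      Matrix.sum_apply, Matrix.smul_apply, Matrix.of_apply, smul_eq_mul, h1,
      Finset.prod_univ_sum, Fintype.piFinset_univ, Finset.prod_mul_distrib, Matrix.mul_apply,
      conjTranspose_apply, star_prod, Finset.mul_sum, Finset.sum_mul]
    have hL : ∀ i : Fin n → ι, (∑ j : Fin n → ι, ∑ a : Fin n → α,
        X i j * ((∏ t, K (a t) (k t) (i t)) * ∏ t, star (K (a t) (l t) (j t)))) =
        ∑ a : Fin n → α, ∑ j : Fin n → ι,
        X i j * ((∏ t, K (a t) (k t) (i t)) * ∏ t, star (K (a t) (l t) (j t))) :=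
      fun i => Finset.sum_comm
    simp only [hL]
    rw [Finset.sum_comm]
    refine Finset.sum_congr rfl fun a _ => ?_
    rw [Finset.sum_comm]
    refine Finset.sum_congr rfl fun j _ => Finset.sum_congr rfl fun i _ => ?_
    ring
  sum_eq_one := by
    ext i j
    have h1 : ∀ x y : ι, ∑ p : α × κ, star (K p.1 p.2 x) * K p.1 p.2 y =
        (1 : Matrix ι ι ℂ) x y := by
      intro x y
      rw [← h.sum_eq_one, Matrix.sum_apply, Fintype.sum_prod_type]
      rfl
    have h2 : (1 : Matrix (Fin n → ι) (Fin n → ι) ℂ) i j = ∏ t, (1 : Matrix ι ι ℂ) (i t) (j t) := by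
      by_cases hij : i = j
      · subst hij; simp
      · obtain ⟨t, ht⟩ := Function.ne_iff.mp hij
        rw [Matrix.one_apply_ne hij, Finset.prod_eq_zero (Finset.mem_univ t)]
        simp [ht]
    rw [h2]
    simp only [← h1, Finset.prod_univ_sum, Fintype.piFinset_univ, Matrix.sum_apply,
      Matrix.mul_apply, conjTranspose_apply, Matrix.of_apply, star_prod, ← Finset.prod_mul_distrib]
    rw [← Fintype.sum_prod_type', ← (Equiv.arrowProdEquivProdArrow (Fin n) _ _).sum_comp]
    rfl

/-- Stated for the bundled class, so that the functional calculus is found for `CStarMatrix`. -/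
theorem exists_eq_star_mul_self {A : Type*} [NonUnitalCStarAlgebra A] [PartialOrder A]
    [StarOrderedRing A] {a : A} (ha : 0 ≤ a) : ∃ b, a = star b * b :=
  CStarAlgebra.nonneg_iff_eq_star_mul_self.mp ha

/-- Choi's theorem: a completely positive trace-preserving map has Kraus operators. They are the
conjugated entries of a matrix `y` with `N(|i⟩⟨j|) = (y† y)_{ij}`. -/
theorem exists_isKraus {ι κ : Type*} [Fintype ι] [DecidableEq ι] [Nonempty ι] [Fintype κ]
    [DecidableEq κ] (N : Matrix ι ι ℂ →CP Matrix κ κ ℂ) (hN : ∀ X, (N X).trace = X.trace) :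
    ∃ K : ι × κ → Matrix κ ι ℂ, IsKraus K N.toLinearMap := by
  obtain ⟨i₀⟩ := ‹Nonempty ι›
  let M : CStarMatrix ι ι (Matrix ι ι ℂ) :=
    CStarMatrix.ofMatrix (Matrix.of fun i j => Matrix.single i j 1)
  -- `M = Y† Y`, where `Y` has the single nonzero block row `(|i₀⟩⟨j|)_j`
  have hM : 0 ≤ M := by
    let Y : CStarMatrix ι ι (Matrix ι ι ℂ) :=
      CStarMatrix.ofMatrix (Matrix.of fun m j => if m = i₀ then Matrix.single i₀ j 1 else 0)
    have : M = star Y * Y := by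
      ext i j : 2
      rw [CStarMatrix.mul_apply, Finset.sum_eq_single i₀]
      · simp [M, Y, CStarMatrix.star_apply, star_eq_conjTranspose]
      · intro m _ hm
        simp [Y, hm]
      · simp
    rw [this]
    exact star_mul_self_nonneg Y
  obtain ⟨y, hy⟩ := exists_eq_star_mul_self (N.map_cstarMatrix_nonneg M hM)
  have h1 : ∀ i j, N (Matrix.single i j 1) = ∑ m, (y m i)ᴴ * y m j := by
    intro i j
    have h2 := congrFun (congrFun hy i) j
    rw [CStarMatrix.mul_apply] at h2
    exact h2
  let K : ι × κ → Matrix κ ι ℂ := fun p => Matrix.of fun k i => star (y p.1 i p.2 k)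
  have hK : ∀ X, N X = ∑ a, K a * X * (K a)ᴴ := by
    intro X
    conv_lhs => rw [Matrix.matrix_eq_sum_single X]
    simp only [map_sum]
    have h3 : ∀ i j, N (Matrix.single i j (X i j)) = X i j • ∑ m, (y m i)ᴴ * y m j := by
      intro i j
      rw [← h1, ← map_smul, Matrix.smul_single, smul_eq_mul, mul_one]
    simp only [h3]
    ext k l
    simp only [Matrix.sum_apply, Matrix.smul_apply, Matrix.mul_apply, conjTranspose_apply, K,
      Matrix.of_apply, star_star, smul_eq_mul, Finset.sum_mul, Finset.mul_sum,
      Fintype.sum_prod_type]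
    rw [Finset.sum_comm]
    have e1 : ∀ j, (∑ i, ∑ m, ∑ p, X i j * (star (y m i p k) * y m j p l)) =
        ∑ m, ∑ p, ∑ i, X i j * (star (y m i p k) * y m j p l) := by
      intro j
      rw [Finset.sum_comm]
      exact Finset.sum_congr rfl fun m _ => Finset.sum_comm
    simp only [e1]
    rw [Finset.sum_comm]
    refine Finset.sum_congr rfl fun m _ => ?_
    rw [Finset.sum_comm]
    refine Finset.sum_congr rfl fun p _ => Finset.sum_congr rfl fun j _ =>
      Finset.sum_congr rfl fun i _ => ?_
    ring
  refine ⟨K, hK, ?_⟩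
  have h4 : ∀ X : Matrix ι ι ℂ, ((∑ a, (K a)ᴴ * K a) * X).trace = (1 * X).trace := by
    intro X
    rw [Matrix.one_mul, ← hN X, hK, Matrix.sum_mul, Matrix.trace_sum, Matrix.trace_sum]
    refine Finset.sum_congr rfl fun a _ => ?_
    rw [Matrix.trace_mul_comm (K a * X), Matrix.mul_assoc]
  exact Matrix.ext_iff_trace_mul_right.mpr h4

/-! ### The symmetric purification -/

/-- The square root of a symmetric operator is symmetric, by uniqueness of the square root. -/
theorem sqrt_comp_perm_of_isSymmetric {ι : Type*} [Fintype ι] [DecidableEq ι] {n : ℕ}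
    {ρ : Matrix (Fin n → ι) (Fin n → ι) ℂ} (hρ : ρ.PosSemidef) (hsym : IsSymmetric ρ)
    (π : Equiv.Perm (Fin n)) (i j : Fin n → ι) :
    CFC.sqrt ρ (i ∘ π) (j ∘ π) = CFC.sqrt ρ i j := by
  let e : (Fin n → ι) ≃ (Fin n → ι) := π.arrowCongr (Equiv.refl ι)
  have he : ∀ i : Fin n → ι, e i = i ∘ π.symm := fun i => rfl
  have hU : ∀ i k : Fin n → ι, (permUnitary π : Matrix (Fin n → ι) (Fin n → ι) ℂ) i k =
      if k = e i then 1 else 0 := by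
    intro i k
    simp only [permUnitary, Matrix.of_apply, he]
    congr 1
    refine propext ⟨?_, ?_⟩
    · rintro rfl; simp [Function.comp_assoc]
    · rintro rfl; simp [Function.comp_assoc]
  have h1 : ρ.submatrix e e = ρ := by
    conv_rhs => rw [← hsym π]
    ext i j
    simp [Matrix.mul_apply, hU, conjTranspose_apply]
  have h2 : CFC.sqrt ρ = (CFC.sqrt ρ).submatrix e e := by
    refine CFC.sqrt_unique ?_ ((CFC.sqrt_nonneg ρ).posSemidef.submatrix e).nonneg
    rw [submatrix_mul_equiv, posSemidef_sqrt_mul_self hρ, h1]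
  conv_lhs => rw [h2]
  simp [he, Function.comp_assoc]

/-- The coefficient matrix of a vector of `ℂ^ι ⊗ ℂ^ι`. -/
def coeffMatrix {ι : Type*} (ψ : ι × ι → ℂ) : Matrix ι ι ℂ := Matrix.of fun i k => ψ (i, k)

theorem reducedState_eq {ι : Type*} [Fintype ι]
    (ψ : Metric.sphere (0 : EuclideanSpace ℂ (ι × ι)) 1) :
    (reducedState ψ).1 = coeffMatrix ψ.1 * (coeffMatrix ψ.1)ᴴ := by
  ext i j
  simp [reducedState, partialTrace, pureState, coeffMatrix, Matrix.mul_apply, vecMulVec_apply]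

theorem tensorPow_reducedState {ι : Type*} [Fintype ι] [DecidableEq ι] (n : ℕ)
    (ψ : Metric.sphere (0 : EuclideanSpace ℂ (ι × ι)) 1) :
    tensorPow n (reducedState ψ).1 =
      tensorPow n (coeffMatrix ψ.1) * (tensorPow n (coeffMatrix ψ.1))ᴴ := by
  rw [conjTranspose_tensorPow, tensorPow_mul, reducedState_eq]

/-- Sums over tuples of pairs, split into pairs of tuples. -/
theorem sum_pair_tuple {ι : Type*} [Fintype ι] {n : ℕ}
    (f : (Fin n → ι) → (Fin n → ι) → ℂ) :
    ∑ p : Fin n → ι × ι, f (Prod.fst ∘ p) (Prod.snd ∘ p) = ∑ i, ∑ k, f i k := by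
  classical
  rw [← Fintype.sum_prod_type', ← (Equiv.arrowProdEquivProdArrow (Fin n) _ _).sum_comp]
  rfl

theorem vecPow_eq_tensorPow {ι : Type*} {n : ℕ} (ψ : ι × ι → ℂ) (p : Fin n → ι × ι) :
    vecPow n ψ p = tensorPow n (coeffMatrix ψ) (Prod.fst ∘ p) (Prod.snd ∘ p) := rfl

/-- The overlap of `ψ^{⊗n}` with the purification `√ρ` of `ρ` is controlled by the fidelity of
the outputs of the channel. -/
theorem norm_sum_vecPow_mul_sqrt_le {α ι κ : Type*} [Fintype α] [DecidableEq α] [Fintype ι]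
    [DecidableEq ι] [Fintype κ] [DecidableEq κ] {n : ℕ} {K : α → Matrix κ ι ℂ}
    {N : Matrix ι ι ℂ →ₗ[ℂ] Matrix κ κ ℂ} (hK : IsKraus K N)
    {ρ : Matrix (Fin n → ι) (Fin n → ι) ℂ} (hρ : ρ.PosSemidef) {τ : Matrix κ κ ℂ}
    (hτ : τ.PosSemidef) (hNρ : tensorPowMap n N ρ = tensorPow n τ)
    (ψ : Metric.sphere (0 : EuclideanSpace ℂ (ι × ι)) 1) :
    ‖∑ p, star (vecPow n ψ.1 p) * CFC.sqrt ρ (Prod.fst ∘ p) (Prod.snd ∘ p)‖ ≤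
      fidelity τ (N (reducedState ψ).1) ^ n := by
  have hNσ : (N (reducedState ψ).1).PosSemidef := by
    rw [hK.map_eq]
    exact posSemidef_sum _ fun a _ => (reducedState ψ).2.1.mul_mul_conjTranspose_same (K a)
  have h1 := (hK.tensorPowMap n).norm_trace_le_fidelity (CFC.sqrt ρ)
    (tensorPow n (coeffMatrix ψ.1))
  rw [conjTranspose_sqrt, posSemidef_sqrt_mul_self hρ, ← tensorPow_reducedState, hNρ] at h1
  have h2 : tensorPowMap n N (tensorPow n (reducedState ψ).1) =
      tensorPow n (N (reducedState ψ).1) := tensorPowMap_tensorProd n N _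
  rw [h2, fidelity_tensorPow n hτ hNσ] at h1
  refine le_of_eq_of_le ?_ h1
  rw [← norm_star]
  congr 1
  have h3 : ∀ i k, star (CFC.sqrt ρ i k) = CFC.sqrt ρ k i := fun i k =>
    congrFun (congrFun (conjTranspose_sqrt ρ) k) i
  simp only [star_sum, star_mul', star_star, vecPow_eq_tensorPow, h3]
  rw [sum_pair_tuple (fun i k => tensorPow n (coeffMatrix ψ.1) i k * CFC.sqrt ρ k i)]
  simp only [Matrix.trace, Matrix.diag, Matrix.mul_apply]
  rw [Finset.sum_comm]
  exact Finset.sum_congr rfl fun k _ => Finset.sum_congr rfl fun i _ => mul_comm _ _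

/-! ### The operator inequality -/

/-- The real part of the quadratic form of a matrix at `v`, as a continuous linear functional. -/
def quadForm {m : Type*} [Fintype m] [DecidableEq m] (v : m → ℂ) : Matrix m m ℂ →L[ℝ] ℝ :=
  LinearMap.toContinuousLinearMap
    { toFun := fun M => (star v ⬝ᵥ (M *ᵥ v)).re
      map_add' := fun A B => by simp [Matrix.add_mulVec]
      map_smul' := fun c A => by simp [Matrix.smul_mulVec] }

theorem quadForm_apply {m : Type*} [Fintype m] [DecidableEq m] (v : m → ℂ) (M : Matrix m m ℂ) :
    quadForm v M = (star v ⬝ᵥ (M *ᵥ v)).re := rfl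

theorem le_of_quadForm_le {m : Type*} [Fintype m] [DecidableEq m] {A B : Matrix m m ℂ}
    (hA : A.IsHermitian) (hB : B.IsHermitian) (h : ∀ v, quadForm v A ≤ quadForm v B) : A ≤ B := by
  rw [Matrix.le_iff]
  refine .of_dotProduct_mulVec_nonneg (hB.sub hA) fun v => ?_
  rw [Complex.nonneg_iff]
  constructor
  · have := h v
    rw [← sub_nonneg, ← map_sub] at this
    exact this
  · exact ((hB.sub hA).im_star_dotProduct_mulVec_self v).symm

/-- The squared norm of `A† v`. -/
theorem quadForm_mul_conjTranspose {m k : Type*} [Fintype m] [DecidableEq m] [Fintype k]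
    (v : m → ℂ) (A : Matrix m k ℂ) :
    quadForm v (A * Aᴴ) = ∑ x, ‖∑ i, star (v i) * A i x‖ ^ 2 := by
  rw [quadForm_apply, ← Matrix.mulVec_mulVec, Matrix.dotProduct_mulVec]
  simp only [dotProduct, Complex.re_sum]
  refine Finset.sum_congr rfl fun x _ => ?_
  have h1 : (Aᴴ *ᵥ v) x = star ((star v ᵥ* A) x) := by
    simp [mulVec, vecMul, dotProduct, conjTranspose_apply, mul_comm]
  rw [h1, show (star v ᵥ* A) x * star ((star v ᵥ* A) x) =
    ((‖(star v ᵥ* A) x‖ ^ 2 : ℝ) : ℂ) by simpa using Complex.mul_conj' _, Complex.ofReal_re]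
  rfl

theorem integrable_of_continuous_state {ι E : Type*} [Fintype ι] [DecidableEq ι] [Nonempty ι]
    [NormedAddCommGroup E] {f : State ι → E} (hf : Continuous f) :
    Integrable f (stateMeasure ι) := by
  rw [stateMeasure, integrable_map_measure hf.aestronglyMeasurable
    (continuous_reducedState ι).measurable.aemeasurable]
  exact (hf.comp (continuous_reducedState ι)).integrable_of_hasCompactSupport
    (.of_compactSpace _)

theorem continuous_tensorPow {ι : Type*} (n : ℕ) :
    Continuous (tensorPow n : Matrix ι ι ℂ → Matrix (Fin n → ι) (Fin n → ι) ℂ) := by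
  refine continuous_matrix fun i j => ?_
  simp only [tensorPow, tensorProd, Matrix.of_apply]
  exact continuous_finsetProd _ fun t _ => continuous_id.matrix_elem _ _

theorem continuous_fidelity_state {ι κ : Type*} [Fintype ι] [DecidableEq ι] [Nonempty ι] [Fintype κ]
    [DecidableEq κ] (N : Matrix ι ι ℂ →CP Matrix κ κ ℂ) (τ : Matrix κ κ ℂ) :
    Continuous fun σ : State ι => fidelity τ (N σ.1) := by
  have hN : Continuous N.toLinearMap := N.toLinearMap.continuous_of_finiteDimensional
  exact (continuousOn_fidelity_right τ).comp_continuous (hN.comp continuous_subtype_val)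
    fun σ => map_nonneg N σ.2.1.nonneg

/-- The heart of the argument: Cauchy–Schwarz on the sphere, applied to the resolution of the
identity of the symmetric subspace by the vectors `ψ^{⊗n}`. -/
theorem quadForm_le_integral {ι κ : Type*} [Fintype ι] [DecidableEq ι] [Nonempty ι]
    [Fintype κ] [DecidableEq κ] {n : ℕ}
    (N : Matrix ι ι ℂ →CP Matrix κ κ ℂ) (hN : ∀ X, (N X).trace = X.trace)
    {ρ : Matrix (Fin n → ι) (Fin n → ι) ℂ} (hρ : ρ.PosSemidef) (hsym : IsSymmetric ρ)
    {τ : Matrix κ κ ℂ} (hτ : τ.PosSemidef)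
    (hNρ : tensorPowMap n N.toLinearMap ρ = tensorPow n τ) (v : (Fin n → ι) → ℂ) :
    quadForm v ρ ≤ (symDim (Fintype.card (ι × ι)) n : ℝ) ^ 2 *
      ∫ σ : State ι, fidelity τ (N σ.1) ^ (2 * n) * quadForm v (tensorPow n σ.1)
        ∂(stateMeasure ι) := by
  obtain ⟨K, hK⟩ := exists_isKraus N hN
  set D : ℝ := (symDim (Fintype.card (ι × ι)) n : ℝ) with hD
  set S := CFC.sqrt ρ with hS
  set q := quadForm v ρ with hq
  -- `φ` is the purification of `ρ`, `w` its contraction with `v`, and `χ = v ⊗ w`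
  let w : (Fin n → ι) → ℂ := fun k => ∑ i, star (v i) * S i k
  let φ : (Fin n → ι × ι) → ℂ := fun p => S (Prod.fst ∘ p) (Prod.snd ∘ p)
  let χ : (Fin n → ι × ι) → ℂ := fun p => v (Prod.fst ∘ p) * w (Prod.snd ∘ p)
  let g : Metric.sphere (0 : EuclideanSpace ℂ (ι × ι)) 1 → ℂ :=
    fun ψ => ∑ p, star (χ p) * vecPow n ψ.1 p
  let h : Metric.sphere (0 : EuclideanSpace ℂ (ι × ι)) 1 → ℂ :=
    fun ψ => ∑ p, star (vecPow n ψ.1 p) * φ p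
  have hqw : q = ∑ k, ‖w k‖ ^ 2 := by
    rw [← quadForm_mul_conjTranspose, conjTranspose_sqrt, posSemidef_sqrt_mul_self hρ]
  have hq0 : 0 ≤ q := by rw [hqw]; positivity
  have hcont : ∀ p : Fin n → ι × ι, Continuous
      fun ψ : Metric.sphere (0 : EuclideanSpace ℂ (ι × ι)) 1 => vecPow n ψ.1 p := by
    intro p
    unfold vecPow
    fun_prop
  have hcg : Continuous g := continuous_finsetSum _ fun p _ => continuous_const.mul (hcont p)
  have hch : Continuous h := continuous_finsetSum _ fun p _ =>
    (hcont p).star.mul continuous_const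
  -- `q = ⟨χ, φ⟩ = D ∫ ⟨χ, ψ^{⊗n}⟩ ⟨ψ^{⊗n}, φ⟩ dψ`, as `φ` is a symmetric vector
  have hqint : (q : ℂ) = D * ∫ ψ, g ψ * h ψ ∂(sphereMeasure (ι × ι)) := by
    have h1 : (q : ℂ) = ∑ p, star (χ p) * φ p := by
      rw [sum_pair_tuple (fun i k => star (v i * w k) * S i k), Finset.sum_comm, hqw]
      push_cast
      refine Finset.sum_congr rfl fun k _ => ?_
      rw [← Complex.conj_mul' (w k)]
      change star (w k) * ∑ i, star (v i) * S i k = _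
      rw [Finset.mul_sum]
      refine Finset.sum_congr rfl fun i _ => ?_
      rw [star_mul']
      ring
    have h2 : ∀ p, φ p = D * ∑ r, (∫ ψ, vecPow n ψ.1 p * star (vecPow n ψ.1 r)
        ∂(sphereMeasure (ι × ι))) * φ r := by
      intro p
      have := sum_integral_mul_of_symmetric φ (fun π p =>
        sqrt_comp_perm_of_isSymmetric hρ hsym π (Prod.fst ∘ p) (Prod.snd ∘ p)) p
      rw [← this, hD]
      push_cast
      rfl
    have hint : ∀ p r, Integrable (fun ψ : Metric.sphere (0 : EuclideanSpace ℂ (ι × ι)) 1 =>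
        star (χ p) * vecPow n ψ.1 p * (star (vecPow n ψ.1 r) * φ r)) (sphereMeasure (ι × ι)) :=
      fun p r => ((continuous_const.mul (hcont p)).mul
        ((hcont r).star.mul continuous_const)).integrable_of_hasCompactSupport (.of_compactSpace _)
    rw [h1]
    simp only [g, h, Finset.sum_mul_sum]
    rw [integral_finsetSum _ fun p _ => integrable_finsetSum _ fun r _ => hint p r,
      Finset.mul_sum]
    refine Finset.sum_congr rfl fun p _ => ?_
    rw [integral_finsetSum _ fun r _ => hint p r, h2 p, mul_left_comm, Finset.mul_sum]
    congr 1
    refine Finset.sum_congr rfl fun r _ => ?_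
    rw [mul_comm _ (φ r), mul_left_comm, ← integral_const_mul, ← integral_const_mul]
    refine integral_congr_ae (.of_forall fun ψ => ?_)
    ring
  let s : Metric.sphere (0 : EuclideanSpace ℂ (ι × ι)) 1 → ℝ :=
    fun ψ => quadForm v (tensorPow n (reducedState ψ).1)
  let f : Metric.sphere (0 : EuclideanSpace ℂ (ι × ι)) 1 → ℝ :=
    fun ψ => fidelity τ (N (reducedState ψ).1)
  have hg : ∀ ψ, ‖g ψ‖ ^ 2 ≤ q * s ψ := by
    intro ψ
    have h1 : g ψ = ∑ k, star (w k) * ∑ i, star (v i) * tensorPow n (coeffMatrix ψ.1) i k := by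
      simp only [g, χ, vecPow_eq_tensorPow]
      rw [sum_pair_tuple (fun i k => star (v i * w k) * tensorPow n (coeffMatrix ψ.1) i k),
        Finset.sum_comm]
      refine Finset.sum_congr rfl fun k _ => ?_
      rw [Finset.mul_sum]
      refine Finset.sum_congr rfl fun i _ => ?_
      rw [star_mul']
      ring
    simp only [s]
    rw [tensorPow_reducedState, quadForm_mul_conjTranspose, hqw, h1]
    calc _ ≤ (∑ k, ‖w k‖ * ‖∑ i, star (v i) * tensorPow n (coeffMatrix ψ.1) i k‖) ^ 2 := by
          gcongr
          refine (norm_sum_le _ _).trans (le_of_eq ?_)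
          simp only [norm_mul, norm_star]
      _ ≤ _ := Finset.sum_mul_sq_le_sq_mul_sq _ _ _
  have hh : ∀ ψ, ‖h ψ‖ ≤ f ψ ^ n := fun ψ => norm_sum_vecPow_mul_sqrt_le hK hρ hτ hNρ ψ
  have hs0 : ∀ ψ, 0 ≤ s ψ := by
    intro ψ
    simp only [s]
    rw [tensorPow_reducedState, quadForm_mul_conjTranspose]
    positivity
  -- the arithmetic-geometric mean inequality replaces the `L²` Cauchy–Schwarz inequality
  have hpt : ∀ ψ, D * ‖g ψ * h ψ‖ ≤ q / 2 + D ^ 2 / 2 * (f ψ ^ (2 * n) * s ψ) := by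
    intro ψ
    have hf : ‖h ψ‖ ^ 2 ≤ f ψ ^ (2 * n) := by
      rw [mul_comm 2 n, pow_mul]
      exact pow_le_pow_left₀ (norm_nonneg _) (hh ψ) 2
    have hb : 0 ≤ D ^ 2 * (f ψ ^ (2 * n) * s ψ) :=
      mul_nonneg (sq_nonneg D) (mul_nonneg ((sq_nonneg _).trans hf) (hs0 ψ))
    have h1 : (D * ‖g ψ * h ψ‖) ^ 2 ≤ q * (D ^ 2 * (f ψ ^ (2 * n) * s ψ)) := by
      rw [norm_mul]
      calc (D * (‖g ψ‖ * ‖h ψ‖)) ^ 2 = D ^ 2 * (‖g ψ‖ ^ 2 * ‖h ψ‖ ^ 2) := by ring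
        _ ≤ D ^ 2 * ((q * s ψ) * f ψ ^ (2 * n)) := by
            gcongr
            · exact mul_nonneg hq0 (hs0 ψ)
            · exact hg ψ
        _ = _ := by ring
    have h2 : (D * ‖g ψ * h ψ‖) ^ 2 ≤ (q / 2 + D ^ 2 / 2 * (f ψ ^ (2 * n) * s ψ)) ^ 2 := by
      nlinarith [sq_nonneg (q - D ^ 2 * (f ψ ^ (2 * n) * s ψ))]
    exact (sq_le_sq₀ (by positivity) (by linarith)).mp h2
  have hcF : Continuous fun σ : State ι =>
      fidelity τ (N σ.1) ^ (2 * n) * quadForm v (tensorPow n σ.1) :=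
    ((continuous_fidelity_state N τ).pow _).mul
      ((quadForm v).continuous.comp ((continuous_tensorPow n).comp continuous_subtype_val))
  have hcfs : Continuous fun ψ => f ψ ^ (2 * n) * s ψ := hcF.comp (continuous_reducedState ι)
  have hifs : Integrable (fun ψ => f ψ ^ (2 * n) * s ψ) (sphereMeasure (ι × ι)) :=
    hcfs.integrable_of_hasCompactSupport (.of_compactSpace _)
  have hmap : ∫ σ : State ι, fidelity τ (N σ.1) ^ (2 * n) * quadForm v (tensorPow n σ.1)
      ∂(stateMeasure ι) = ∫ ψ, f ψ ^ (2 * n) * s ψ ∂(sphereMeasure (ι × ι)) :=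
    integral_map (continuous_reducedState ι).measurable.aemeasurable hcF.aestronglyMeasurable
  rw [hmap]
  have hle : q ≤ q / 2 + D ^ 2 / 2 * ∫ ψ, f ψ ^ (2 * n) * s ψ ∂(sphereMeasure (ι × ι)) := by
    calc q = ‖(q : ℂ)‖ := by rw [Complex.norm_real, Real.norm_of_nonneg hq0]
      _ = D * ‖∫ ψ, g ψ * h ψ ∂(sphereMeasure (ι × ι))‖ := by
          rw [hqint, norm_mul, Complex.norm_real, Real.norm_of_nonneg (by positivity)]
      _ ≤ D * ∫ ψ, ‖g ψ * h ψ‖ ∂(sphereMeasure (ι × ι)) := by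
          gcongr
          exact norm_integral_le_integral_norm _
      _ = ∫ ψ, D * ‖g ψ * h ψ‖ ∂(sphereMeasure (ι × ι)) := (integral_const_mul _ _).symm
      _ ≤ ∫ ψ, (q / 2 + D ^ 2 / 2 * (f ψ ^ (2 * n) * s ψ)) ∂(sphereMeasure (ι × ι)) := by
          refine integral_mono ?_ ((integrable_const _).add (hifs.const_mul _)) hpt
          exact (continuous_const.mul (hcg.mul hch).norm).integrable_of_hasCompactSupport
            (.of_compactSpace _)
      _ = _ := by
          rw [integral_add (integrable_const _) (hifs.const_mul _), integral_const_mul]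
          simp
  linarith

end DeFinetti

end

open DeFinetti MeasureTheory in
theorem mainTheorem8 {ι κ : Type*} [Fintype ι] [DecidableEq ι] [Nonempty ι]
    [Fintype κ] [DecidableEq κ] (n : ℕ)
    (N : Matrix ι ι ℂ →CP Matrix κ κ ℂ) (hN : ∀ X, (N X).trace = X.trace)
    (ρ : State (Fin n → ι)) (hρ : IsSymmetric ρ.1) (τ₀ : State κ)
    (hNρ : tensorPowMap n N.toLinearMap ρ.1 = tensorPow n τ₀.1) :
    ρ.1 ≤ ((n : ℝ) + 1) ^ (3 * Fintype.card ι ^ 2) •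
        ∫ σ : State ι, fidelity τ₀.1 (N σ.1) ^ (2 * n) • tensorPow n σ.1 ∂(stateMeasure ι) ∧
    ∀ δ : ℝ, 0 < δ → δ < 1 →
      ρ.1 ≤ ((n : ℝ) + 1) ^ (3 * Fintype.card ι ^ 2) •
        ((∫ σ in {σ : State ι | 1 - δ ≤ fidelity τ₀.1 (N σ.1)},
            tensorPow n σ.1 ∂(stateMeasure ι)) +
          (1 - δ) ^ (2 * n) •
            ∫ σ in {σ : State ι | 1 - δ ≤ fidelity τ₀.1 (N σ.1)}ᶜ,
              tensorPow n σ.1 ∂(stateMeasure ι)) := by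
  have hcF := continuous_fidelity_state N τ₀.1
  have hcT : Continuous fun σ : State ι => tensorPow n σ.1 :=
    (continuous_tensorPow n).comp continuous_subtype_val
  have hT0 : ∀ σ : State ι, 0 ≤ tensorPow n σ.1 := fun σ =>
    (posSemidef_tensorPow n σ.2.1).nonneg
  have hF0 : ∀ σ : State ι, 0 ≤ fidelity τ₀.1 (N σ.1) := fun σ => fidelity_nonneg _ _
  have hF1 : ∀ σ : State ι, fidelity τ₀.1 (N σ.1) ≤ 1 := fun σ =>
    fidelity_le_one τ₀.2.1 (Matrix.nonneg_iff_posSemidef.mp (map_nonneg N σ.2.1.nonneg))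
      τ₀.2.2 (by rw [hN, σ.2.2])
  have hint : Integrable (fun σ : State ι => fidelity τ₀.1 (N σ.1) ^ (2 * n) • tensorPow n σ.1)
      (stateMeasure ι) := integrable_of_continuous_state ((hcF.pow _).smul hcT)
  have hintT : Integrable (fun σ : State ι => tensorPow n σ.1) (stateMeasure ι) :=
    integrable_of_continuous_state hcT
  have hI0 : 0 ≤ ∫ σ : State ι, fidelity τ₀.1 (N σ.1) ^ (2 * n) • tensorPow n σ.1
      ∂(stateMeasure ι) :=
    integral_nonneg fun σ => smul_nonneg (pow_nonneg (hF0 σ) _) (hT0 σ)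
  have hC : (symDim (Fintype.card (ι × ι)) n : ℝ) ^ 2 ≤
      ((n : ℝ) + 1) ^ (3 * Fintype.card ι ^ 2) := by
    have h1 : (symDim (Fintype.card (ι × ι)) n : ℝ) ≤ ((n : ℝ) + 1) ^ Fintype.card (ι × ι) := by
      exact_mod_cast symDim_le _ n Fintype.card_pos
    calc (symDim (Fintype.card (ι × ι)) n : ℝ) ^ 2
        ≤ (((n : ℝ) + 1) ^ Fintype.card (ι × ι)) ^ 2 := by gcongr
      _ = ((n : ℝ) + 1) ^ (2 * Fintype.card ι ^ 2) := by
          rw [← pow_mul, Fintype.card_prod]; ring_nf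
      _ ≤ _ := pow_le_pow_right₀ (by linarith [Nat.cast_nonneg (α := ℝ) n]) (by omega)
  have hfirst : ρ.1 ≤ ((n : ℝ) + 1) ^ (3 * Fintype.card ι ^ 2) •
      ∫ σ : State ι, fidelity τ₀.1 (N σ.1) ^ (2 * n) • tensorPow n σ.1 ∂(stateMeasure ι) := by
    refine le_trans ?_ (smul_le_smul_of_nonneg_right hC hI0)
    refine le_of_quadForm_le ρ.2.1.1
      (Matrix.nonneg_iff_posSemidef.mp (smul_nonneg (sq_nonneg _) hI0)).1 fun v => ?_
    rw [map_smul, ← ContinuousLinearMap.integral_comp_comm _ hint]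
    simp only [map_smul, smul_eq_mul]
    exact quadForm_le_integral N hN ρ.2.1 hρ τ₀.2.1 hNρ v
  refine ⟨hfirst, fun δ _ hδ1 => hfirst.trans ?_⟩
  have hmeas : MeasurableSet {σ : State ι | 1 - δ ≤ fidelity τ₀.1 (N σ.1)} :=
    (isClosed_le continuous_const hcF).measurableSet
  refine smul_le_smul_of_nonneg_left ?_ (by positivity)
  rw [← integral_add_compl hmeas hint, ← integral_smul]
  refine add_le_add ?_ ?_
  · refine setIntegral_mono_on hint.integrableOn hintT.integrableOn hmeas fun σ _ => ?_
    exact smul_le_of_le_one_left (hT0 σ) (pow_le_one₀ (hF0 σ) (hF1 σ))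
  · have hintT' : Integrable (fun σ : State ι => (1 - δ) ^ (2 * n) • tensorPow n σ.1)
        (stateMeasure ι) := hintT.smul ((1 - δ) ^ (2 * n))
    refine setIntegral_mono_on hint.integrableOn hintT'.integrableOn hmeas.compl
      fun σ hσ => ?_
    have hlt : fidelity τ₀.1 (N σ.1) < 1 - δ := not_le.mp fun h => hσ h
    exact smul_le_smul_of_nonneg_right (pow_le_pow_left₀ (hF0 σ) hlt.le _) (hT0 σ)
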